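/- Let $N=\{1,\dots,n\}$, $n\ge 3$, be a set of agents, each with valuation set $V=[0,\beta]$, $\beta\in\mathbb R$. An allocation rule is a map $f:V^n\to[0,1]^n$ with $\sum_{i\in N} f_i(\mathbf v)\le 1$ for all $\mathbf v\in V^n$; a mechanism is a pair $(f,\mathbf p)$ of an allocation rule and payment rules $\mathbf p=(p_1,\dots,p_n)$, $p_i:V^n\to\mathbb R$. A mechanism $(f,\mathbf p)$ is - dominant strategy incentive compatible if $v_if_i(v_i,v_{-i})-p_i(v_i,v_{-i})\ge v_if_i(v_i',v_{-i})-p_i(v_i',v_{-i})$ for all $i\in N$, all $v_i,v_i'\in V$ and all $v_{-i}\in V^{N\setminus\{i\}}$; - budget-balanced if $\sum_{i\in N}p_i(\mathbf v)=0$ for all $\mathbf v\in V^n$; - symmetric if $f_i(\mathbf v)=f_j(\mathbf v)$ and $p_i(\mathbf v)=p_j(\mathbf v)$ whenever $v_i=v_j$; - satisfactory if it has these three properties; - ex-post individually rational if $v_if_i(\mathbf v)-p_i(\mathbf v)\ge 0$ for all $i\in N$ and $\mathbf v\in V^n$. For a profile $\mathbf v$ and $k\ge 1$ let $\mathbf v[k]$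 be the set of agents with the $k$-th highest valuation, that is, recursively, the agents in $N\setminus\bigcup_{j<k}\mathbf v[j]$ whose valuation is highest among the agents in this set, and let $L_k(\mathbf v)=\big|\bigcup_{j\le k}\mathbf v[j]\big|$. An allocation rule $f$ is a ranking allocation rule with probabilities $(\pi_1,\dots,\pi_n)$, where $\pi_i\in[0,1]$, $\pi_1\ge\dots\ge\pi_n$ and $\sum_i\pi_i\le 1$, if $f_i(\mathbf v)=f_j(\mathbf v)$ whenever $v_i=v_j$, and $$\sum_{i\in\bigcup_{j\le k}\mathbf v[j]}f_i(\mathbf v)=\sum_{i=1}^{L_k(\mathbf v)}\pi_i\qquad\text{for all }\mathbf v\in V^n,\ k\in N.$$ For an integer $1\le\ell\le n$, it is the two-step ranking allocation rule defined by $(\pi_1,\ell)$ if its probabilities are $(\pi_1,\pi_2,\dots,\pi_2,0,\dots,0)$ with $\ell-1$ entries $\pi_2$, where $\pi_1>\pi_2>0$ and $\pi_1+(\ell-1)\pi_2=1$. **Theorem.** Suppose $f$ is a two-step ranking allocation rule defined by $(\pi_1,\ell)$, where $2\ell\le n+1$. If $(f,\mathbf p)$ is a satisfactory mechanism, then it is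 ex-post individually rational. -/

import Mathlib

namespace SingleObject

/-- The valuation profiles of `n` agents, where the set of valuations of every agent is `[0, β]`. -/
abbrev Profile (n : ℕ) (β : ℝ) : Type := Fin n → Set.Icc (0 : ℝ) β

/-- An allocation rule: `f v i` is the probability that agent `i` gets the object at profile `v`;
the object is allocated with total probability at most one. -/
structure AllocationRule (n : ℕ) (β : ℝ) where
  /-- the allocation probabilities -/
  prob : Profile n β → Fin n → ℝ
  prob_nonneg : ∀ v i, 0 ≤ prob v i
  prob_le_one : ∀ v i, prob v i ≤ 1
  sum_prob_le_one : ∀ v, ∑ i, prob v i ≤ 1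

instance (n : ℕ) (β : ℝ) : CoeFun (AllocationRule n β) (fun _ => Profile n β → Fin n → ℝ) :=
  ⟨AllocationRule.prob⟩

/-- A collection of payment rules: `p v i` is the payment of agent `i` at profile `v`. -/
abbrev PaymentRule (n : ℕ) (β : ℝ) : Type := Profile n β → Fin n → ℝ

variable {n : ℕ} {β : ℝ}

/-- Dominant strategy incentive compatibility: no agent gains by reporting `x` in place of his
valuation, whatever the other valuations are. -/
def IsDSIC (f : AllocationRule n β) (p : PaymentRule n β) : Prop :=
  ∀ (i : Fin n) (v : Profile n β) (x : Set.Icc (0 : ℝ) β),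
    (v i : ℝ) * f v i - p v i ≥
      (v i : ℝ) * f (Function.update v i x) i - p (Function.update v i x) i

/-- Budget balance. -/
def IsBudgetBalanced (p : PaymentRule n β) : Prop :=
  ∀ v : Profile n β, ∑ i, p v i = 0

/-- Symmetry of an allocation rule: agents with equal valuations get equal probabilities. -/
def AllocationRule.IsSymmetric (f : AllocationRule n β) : Prop :=
  ∀ (v : Profile n β) (i j : Fin n), v i = v j → f v i = f v j

/-- Symmetry of a mechanism: agents with equal valuations get equal probabilities and make equal
payments. -/
def IsSymmetricMechanism (f : AllocationRule n β) (p : PaymentRule n β) : Prop :=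
  ∀ (v : Profile n β) (i j : Fin n), v i = v j → f v i = f v j ∧ p v i = p v j

/-- A satisfactory mechanism. -/
structure IsSatisfactory (f : AllocationRule n β) (p : PaymentRule n β) : Prop where
  dsic : IsDSIC f p
  budgetBalanced : IsBudgetBalanced p
  symmetric : IsSymmetricMechanism f p

/-- Ex-post individual rationality: every agent's net utility is nonnegative at every profile. -/
def IsExPostIR (f : AllocationRule n β) (p : PaymentRule n β) : Prop :=
  ∀ (i : Fin n) (v : Profile n β), (v i : ℝ) * f v i - p v i ≥ 0

/-- The agents outside `S` whose valuation is highest among the agents outside `S`. -/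
def highestOutside {α : Type*} [LinearOrder α] (v : Fin n → α) (S : Finset (Fin n)) :
    Finset (Fin n) :=
  {i | i ∉ S ∧ ∀ j, j ∉ S → v j ≤ v i}

/-- `topAgents v k` is `v[1] ∪ ⋯ ∪ v[k]`, where `v[k+1] = highestOutside v (v[1] ∪ ⋯ ∪ v[k])` is
the set of agents with the `(k+1)`-th highest valuation. -/
def topAgents {α : Type*} [LinearOrder α] (v : Fin n → α) : ℕ → Finset (Fin n)
  | 0 => ∅
  | k + 1 => topAgents v k ∪ highestOutside v (topAgents v k)

/-- `f` is a ranking allocation rule with probabilities `π 0 ≥ π 1 ≥ ⋯ ≥ π (n-1)`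
(ranks are counted from `0`): for every `k`, the agents in `v[1] ∪ ⋯ ∪ v[k]` together get the sum of
the first `|v[1] ∪ ⋯ ∪ v[k]|` probabilities. -/
structure AllocationRule.IsRanking (f : AllocationRule n β) (π : Fin n → ℝ) : Prop where
  symmetric : f.IsSymmetric
  nonneg : ∀ i, 0 ≤ π i
  le_one : ∀ i, π i ≤ 1
  antitone : Antitone π
  sum_le_one : ∑ i, π i ≤ 1
  sum_eq : ∀ (v : Profile n β) (k : ℕ), 1 ≤ k → k ≤ n →
    ∑ i ∈ topAgents v k, f v i =
      ∑ i ∈ Finset.univ.filter (fun i : Fin n => (i : ℕ) < (topAgents v k).card), π i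

/-- The vector `(π₁, π₂, …, π₂, 0, …, 0)` with `ℓ - 1` entries `π₂`. -/
noncomputable def twoStepProb (n : ℕ) (π₁ π₂ : ℝ) (ℓ : ℕ) (i : Fin n) : ℝ :=
  if (i : ℕ) = 0 then π₁ else if (i : ℕ) < ℓ then π₂ else 0

/-- `f` is the two-step ranking allocation rule defined by `(π₁, ℓ)`. -/
def AllocationRule.IsTwoStepRanking (f : AllocationRule n β) (π₁ : ℝ) (ℓ : ℕ) : Prop :=
  1 ≤ ℓ ∧ ℓ ≤ n ∧ ∃ π₂ : ℝ, π₁ > π₂ ∧ π₂ > 0 ∧ π₁ + ((ℓ : ℝ) - 1) * π₂ = 1 ∧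
    f.IsRanking (twoStepProb n π₁ π₂ ℓ)

end SingleObject

/-!
The utility of agent `i` at `v` splits into the part he earns by his own report and the base utility
`u i (v with v i := 0)`. The first part is nonnegative, being the integral of his allocation
probability (`utility_eq_add_integral`), so individual rationality means that base utilities are
nonnegative.

The argument works with thresholds instead of order statistics. Let `N v t` be the number of agents
whose valuation exceeds `t` (`countAbove`), let `q r` be the probability of the rank `r` (counted
from `0`) and let `P m = ∑ r < m, q r`. The agents above a threshold receive `P (N v t)` together
(`sum_prob_upper`), so that, by budget balance, the utilities add up to the integral of `P (N v t)`
over `t ∈ [0, β]`. Let `φ 0 = 0` and let `φ` solve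
`m φ(m - 1) + (n - m) φ(m) = P m - m q(m - 1)` for `1 ≤ m < n` (`baseWeight`). Comparing integrands
and inducting on the number of nonzero valuations, where symmetry identifies the base utilities
of all agents of valuation zero, yields that an agent of valuation zero has the utility
`∫ φ (N v t) dt` (`utility_eq_integral_baseWeight`). Hence it is enough that `φ ≥ 0` on
`{0, …, n - 1}`.

The profile at which everyone has the valuation `β` gives the remaining equation, the one at `m = n`
(`card_mul_baseWeight_pred`). For a two-step rule the right-hand side is `A = π₁ - π₂` for
`2 ≤ m ≤ ℓ` and `1` for `m > ℓ`. Going down from `m = n`, the equations force `φ = 1 / n` on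
`{ℓ, …, n - 1}`. Going up from `φ 1 = 0`, the deviation of `φ` from `A / n` is multiplied by
`-m / (n - m)` in each step, which has absolute value at most one as long as `2 m ≤ n`; this covers
`m < ℓ` because `2 ℓ ≤ n + 1`. Thus `|φ m - A / n| ≤ A / n` and `φ m ≥ 0`.
-/

namespace SingleObject

open Finset MeasureTheory

/-! ### Ranking rules on upper sets -/

/-- Every set of agents that contains with an agent all agents of at least his valuation is of the
form `v[1] ∪ ⋯ ∪ v[k]`. -/
theorem exists_topAgents_eq {n : ℕ} {α : Type*} [LinearOrder α] (v : Fin n → α)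
    (U : Finset (Fin n)) (hU : ∀ i ∈ U, ∀ j, v i ≤ v j → j ∈ U) :
    ∃ k ≤ n, topAgents v k = U := by
  have key : ∀ k ≤ n, (∃ k' ≤ n, topAgents v k' = U) ∨
      (topAgents v k ⊂ U ∧ k ≤ (topAgents v k).card) := by
    intro k
    induction k with
    | zero =>
      intro _
      rcases U.eq_empty_or_nonempty with rfl | h
      · exact Or.inl ⟨0, Nat.zero_le _, rfl⟩
      · exact Or.inr ⟨by simpa [topAgents, Finset.empty_ssubset] using h, Nat.zero_le _⟩
    | succ k ih =>
      intro hk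
      rcases ih (by omega) with h | ⟨hss, hcard⟩
      · exact Or.inl h
      obtain ⟨x, hxU, hxS⟩ := Finset.exists_of_ssubset hss
      have hsub : topAgents v (k + 1) ⊆ U := by
        refine Finset.union_subset hss.subset fun i hi => ?_
        simp only [highestOutside, Finset.mem_filter, Finset.mem_univ, true_and] at hi
        exact hU x hxU i (hi.2 x hxS)
      obtain ⟨y, hy, hmax⟩ := Finset.exists_max_image (univ \ topAgents v k) v
        ⟨x, by simpa using hxS⟩
      have hy' : y ∉ topAgents v k := by simpa using hy
      have hlt : topAgents v k ⊂ topAgents v (k + 1) := by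
        refine Finset.ssubset_iff_subset_ne.2 ⟨Finset.subset_union_left, fun h => hy' ?_⟩
        rw [h]
        refine Finset.mem_union_right _ ?_
        simp only [highestOutside, Finset.mem_filter, Finset.mem_univ, true_and]
        exact ⟨hy', fun j hj => hmax j (by simpa using hj)⟩
      by_cases hEq : topAgents v (k + 1) = U
      · exact Or.inl ⟨k + 1, hk, hEq⟩
      · have := Finset.card_lt_card hlt
        exact Or.inr ⟨Finset.ssubset_iff_subset_ne.2 ⟨hsub, hEq⟩, by omega⟩
  rcases key n le_rfl with h | ⟨hss, hcard⟩
  · exact h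
  · have h1 := Finset.card_lt_card hss
    have h2 := Finset.card_le_univ U
    rw [Fintype.card_fin] at h2
    omega

section Ranking

variable {n : ℕ} {β : ℝ} {f : AllocationRule n β} {q : ℕ → ℝ}

/-- The agents of an upper set together get the probabilities of the highest ranks. -/
theorem sum_prob_upper (hf : f.IsRanking fun i => q i) (v : Profile n β) (U : Finset (Fin n))
    (hU : ∀ i ∈ U, ∀ j, v i ≤ v j → j ∈ U) :
    ∑ i ∈ U, f v i = ∑ r ∈ range U.card, q r := by
  obtain ⟨k, hk, rfl⟩ := exists_topAgents_eq v U hU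
  rcases Nat.eq_zero_or_pos k with rfl | hpos
  · simp [topAgents]
  rw [hf.sum_eq v k hpos hk]
  have hc := Finset.card_le_univ (topAgents v k)
  rw [Fintype.card_fin] at hc
  rw [Finset.sum_filter, Fin.sum_univ_eq_sum_range (fun i : ℕ =>
    if i < (topAgents v k).card then q i else 0) n, ← Finset.sum_filter]
  congr 1
  ext r
  simp only [Finset.mem_filter, Finset.mem_range]
  omega

/-- An agent who is not tied with anybody gets the probability of his rank. -/
theorem prob_eq_of_forall_ne (hf : f.IsRanking fun i => q i) (v : Profile n β) (i : Fin n)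
    (hi : ∀ j, j ≠ i → v j ≠ v i) :
    f v i = q (univ.filter fun j => v i < v j).card := by
  have h1 := sum_prob_upper hf v (univ.filter fun j => v i < v j) (by
    simp only [Finset.mem_filter, Finset.mem_univ, true_and]
    exact fun a ha j hj => ha.trans_le hj)
  have hmem : i ∉ univ.filter fun j => v i < v j := by simp
  have h2 := sum_prob_upper hf v (insert i (univ.filter fun j => v i < v j)) (by
    simp only [Finset.mem_insert, Finset.mem_filter, Finset.mem_univ, true_and]
    rintro a (rfl | ha) j hj
    · by_cases hja : j = a
      · exact Or.inl hja
      · exact Or.inr (lt_of_le_of_ne hj (hi j hja).symm)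
    · exact Or.inr (ha.trans_le hj))
  rw [Finset.sum_insert hmem, Finset.card_insert_of_notMem hmem, Finset.sum_range_succ, h1] at h2
  linarith

end Ranking

/-! ### Counting the agents above a threshold -/

section CountAbove

variable {n : ℕ} {β : ℝ}

/-- The number of agents whose valuation exceeds `t`. -/
noncomputable def countAbove (v : Profile n β) (t : ℝ) : ℕ :=
  (univ.filter fun j => t < (v j : ℝ)).card

theorem countAbove_le (v : Profile n β) (t : ℝ) : countAbove v t ≤ n := by
  simpa [countAbove] using Finset.card_le_univ (univ.filter fun j => t < (v j : ℝ))

theorem measurable_countAbove (v : Profile n β) : Measurable (countAbove v) := by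
  refine Antitone.measurable fun s t hst => Finset.card_le_card fun j hj => ?_
  simp only [Finset.mem_filter, Finset.mem_univ, true_and] at hj ⊢
  exact hst.trans_lt hj

theorem intervalIntegrable_comp_countAbove (v : Profile n β) (g : ℕ → ℝ) (a b : ℝ) :
    IntervalIntegrable (fun t => g (countAbove v t)) volume a b := by
  refine (intervalIntegrable_const (c := ∑ k ∈ range (n + 1), |g k|)).mono_fun
    ((measurable_from_nat.comp (measurable_countAbove v)).aestronglyMeasurable)
    (Filter.Eventually.of_forall fun t => ?_)
  simp only [Real.norm_eq_abs]
  refine le_trans ?_ (le_abs_self _)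
  exact Finset.single_le_sum (f := fun k => |g k|) (fun k _ => abs_nonneg _)
    (Finset.mem_range.2 (Nat.lt_succ_of_le (countAbove_le v t)))

/-- Restricting an integrand to the thresholds below `x ∈ [0, β]`. -/
theorem intervalIntegrable_ite_lt {h : ℝ → ℝ} (hh : IntervalIntegrable h volume 0 β) (x : ℝ) :
    IntervalIntegrable (fun t => if t < x then h t else 0) volume 0 β := by
  have : (fun t => if t < x then h t else 0) = (Set.Iio x).indicator h := by
    ext t; simp [Set.indicator_apply]
  rw [this]
  exact ⟨hh.1.indicator measurableSet_Iio, hh.2.indicator measurableSet_Iio⟩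

theorem integral_ite_lt {h : ℝ → ℝ} (hh : IntervalIntegrable h volume 0 β) {x : ℝ}
    (hx : x ∈ Set.Icc 0 β) :
    ∫ t in (0 : ℝ)..β, (if t < x then h t else 0) = ∫ t in (0 : ℝ)..x, h t := by
  have hi := intervalIntegrable_ite_lt hh x
  have hsub1 : Set.uIcc 0 x ⊆ Set.uIcc 0 β := by
    rw [Set.uIcc_of_le hx.1, Set.uIcc_of_le (hx.1.trans hx.2)]
    exact Set.Icc_subset_Icc_right hx.2
  have hsub2 : Set.uIcc x β ⊆ Set.uIcc 0 β := by
    rw [Set.uIcc_of_le hx.2, Set.uIcc_of_le (hx.1.trans hx.2)]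
    exact Set.Icc_subset_Icc_left hx.1
  rw [← intervalIntegral.integral_add_adjacent_intervals (hi.mono_set hsub1) (hi.mono_set hsub2)]
  have h1 : ∫ t in (0 : ℝ)..x, (if t < x then h t else 0) = ∫ t in (0 : ℝ)..x, h t := by
    -- the integrands differ at the endpoint `x` only
    refine intervalIntegral.integral_congr_ae ?_
    filter_upwards [compl_mem_ae_iff.2 (measure_singleton (μ := volume) x)] with t ht htx
    rw [Set.uIoc_of_le hx.1] at htx
    exact if_pos (lt_of_le_of_ne htx.2 ht)
  have h2 : ∫ t in x..β, (if t < x then h t else 0) = 0 := by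
    refine (intervalIntegral.integral_congr (g := fun _ => 0) fun t ht => ?_).trans
      intervalIntegral.integral_zero
    rw [Set.uIcc_of_le hx.2] at ht
    exact if_neg (not_lt.2 ht.1)
  rw [h1, h2, add_zero]

/-- Replacing the valuation of `i` by zero removes `i` from the agents above a threshold. -/
theorem countAbove_update_zero (v : Profile n β) (i : Fin n) {z : Set.Icc (0 : ℝ) β}
    (hz : (z : ℝ) = 0) {t : ℝ} (ht : 0 ≤ t) :
    countAbove (Function.update v i z) t =
      if t < (v i : ℝ) then countAbove v t - 1 else countAbove v t := by
  have hset : (univ.filter fun j => t < (Function.update v i z j : ℝ)) =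
      (univ.filter fun j => t < (v j : ℝ)).erase i := by
    ext j
    by_cases hj : j = i
    · subst hj; simp [hz, ht]
    · simp [hj]
  rw [countAbove, hset]
  split_ifs with h
  · rw [Finset.card_erase_of_mem (by simpa using h), countAbove]
  · rw [Finset.erase_eq_of_notMem (by simpa using h), countAbove]

end CountAbove

/-! ### Utilities and the envelope formula -/

section Utility

variable {n : ℕ} {β : ℝ} {f : AllocationRule n β} {p : PaymentRule n β} {q : ℕ → ℝ}

/-- The net utility of agent `i` when everybody reports truthfully. -/
def utility (f : AllocationRule n β) (p : PaymentRule n β) (v : Profile n β) (i : Fin n) : ℝ :=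
  (v i : ℝ) * f v i - p v i

/-- Incentive compatibility as a subgradient inequality. -/
theorem utility_update_ge (hd : IsDSIC f p) (v : Profile n β) (i : Fin n)
    (x y : Set.Icc (0 : ℝ) β) :
    utility f p (Function.update v i y) i + ((x : ℝ) - y) * f (Function.update v i y) i ≤
      utility f p (Function.update v i x) i := by
  have := hd i (Function.update v i x) y
  simp only [Function.update_self, Function.update_idem] at this
  simp only [utility, Function.update_self]
  linarith

/-- Own valuations enter the utility through the integral of the probability of the rank that
a report earns. -/
theorem utility_eq_add_integral (hf : f.IsRanking fun i => q i) (hd : IsDSIC f p)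
    (v : Profile n β) (i : Fin n) {z : Set.Icc (0 : ℝ) β} (hz : (z : ℝ) = 0) :
    utility f p v i = utility f p (Function.update v i z) i +
      ∫ t in (0 : ℝ)..(v i), q (countAbove (Function.update v i z) t) := by
  have hβ : (0 : ℝ) ≤ β := z.2.1.trans z.2.2
  set w := Function.update v i z with hw
  let r : ℝ → Profile n β := fun t => Function.update v i (Set.projIcc 0 β hβ t)
  have hproj : ∀ t ∈ Set.Icc (0 : ℝ) β, ((Set.projIcc 0 β hβ t : Set.Icc (0 : ℝ) β) : ℝ) = t :=
    fun t ht => by rw [Set.projIcc_of_mem hβ ht]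
  let g : ℝ → ℝ := fun t => utility f p (r t) i
  have hsub : ∀ s ∈ Set.Icc (0 : ℝ) β, ∀ t ∈ Set.Icc (0 : ℝ) β,
      g t + (s - t) * f (r t) i ≤ g s := by
    intro s hs t ht
    have := utility_update_ge hd v i (Set.projIcc 0 β hβ s) (Set.projIcc 0 β hβ t)
    rwa [hproj s hs, hproj t ht] at this
  have hmem : ∀ t ∈ Set.Icc (0 : ℝ) (v i), t ∈ Set.Icc (0 : ℝ) β :=
    fun t ht => ⟨ht.1, ht.2.trans (v i).2.2⟩
  have hcont : ContinuousOn g (Set.Icc (0 : ℝ) (v i)) := by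
    have hlip : LipschitzOnWith 1 g (Set.Icc (0 : ℝ) (v i)) := by
      refine LipschitzOnWith.of_le_add_mul 1 fun s hs t ht => ?_
      have h1 := hsub t (hmem t ht) s (hmem s hs)
      have h2 := f.prob_nonneg (r s) i
      have h3 := f.prob_le_one (r s) i
      have h4 : (s - t) * f (r s) i ≤ dist s t :=
        calc (s - t) * f (r s) i ≤ |s - t| * f (r s) i :=
              mul_le_mul_of_nonneg_right (le_abs_self _) h2
          _ ≤ |s - t| * 1 := mul_le_mul_of_nonneg_left h3 (abs_nonneg _)
          _ = dist s t := by rw [mul_one, Real.dist_eq]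
      simp only [NNReal.coe_one, one_mul]
      linarith
    exact hlip.continuousOn
  -- off the other agents' valuations, the report `t` is untied and earns a well-defined rank
  have hprob : ∀ t ∈ Set.Icc (0 : ℝ) β, (∀ j, t ≠ (v j : ℝ)) → f (r t) i = q (countAbove w t) := by
    intro t ht hne
    rw [prob_eq_of_forall_ne hf (r t) i]
    · congr 2
      ext j
      simp only [Finset.mem_filter, Finset.mem_univ, true_and, ← Subtype.coe_lt_coe]
      by_cases hj : j = i
      · subst hj; simp [hw, hz, ht.1]
      · simp [r, hw, hj, hproj t ht]
    · intro j hj h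
      simp only [r, Function.update_self, Function.update_of_ne hj] at h
      exact hne j (by rw [h, hproj t ht])
  have hderiv : ∀ t ∈ Set.Ioo (0 : ℝ) (v i) \ Set.range (fun j => (v j : ℝ)),
      HasDerivAt g (q (countAbove w t)) t := by
    rintro t ⟨ht, htr⟩
    have hne : ∀ j, t ≠ (v j : ℝ) := fun j h => htr ⟨j, h.symm⟩
    have hev : ∀ᶠ s in nhds t, s ∈ Set.Ioo (0 : ℝ) (v i) ∧
        ∀ j, s ≠ (v j : ℝ) ∧ (s < (v j : ℝ) ↔ t < (v j : ℝ)) := by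
      refine Filter.Eventually.and (isOpen_Ioo.mem_nhds ht) (Filter.eventually_all.2 fun j => ?_)
      rcases lt_or_gt_of_ne (hne j) with h | h
      · filter_upwards [isOpen_Iio.mem_nhds h] with s hs
        exact ⟨ne_of_lt hs, iff_of_true hs h⟩
      · filter_upwards [isOpen_Ioi.mem_nhds h] with s hs
        exact ⟨ne_of_gt hs, iff_of_false (not_lt.2 (le_of_lt hs)) (not_lt.2 h.le)⟩
    have htI := hmem t (Set.Ioo_subset_Icc_self ht)
    have hlin : g =ᶠ[nhds t] fun s => g t + (s - t) * q (countAbove w t) := by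
      filter_upwards [hev] with s hs
      have hsI := hmem s (Set.Ioo_subset_Icc_self hs.1)
      have hcount : countAbove w s = countAbove w t := by
        simp only [countAbove]
        congr 1
        ext j
        simp only [Finset.mem_filter, Finset.mem_univ, true_and]
        by_cases hj : j = i
        · subst hj; simp [hw, hz, htI.1.not_gt, hsI.1.not_gt]
        · simpa [hw, hj] using (hs.2 j).2
      have h1 := hsub s hsI t htI
      have h2 := hsub t htI s hsI
      rw [hprob t htI hne] at h1
      rw [hprob s hsI fun j => (hs.2 j).1, hcount] at h2
      linarith
    refine HasDerivAt.congr_of_eventuallyEq ?_ hlin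
    simpa using (((hasDerivAt_id t).sub_const t).mul_const (q (countAbove w t))).const_add (g t)
  have hFTC := integral_eq_of_hasDerivAt_off_countable_of_le g (fun t => q (countAbove w t))
    (v i).2.1 (Set.countable_range fun j => (v j : ℝ)) hcont hderiv
    (intervalIntegrable_comp_countAbove w q _ _)
  have e1 : g (v i) = utility f p v i := by simp [g, r]
  have e2 : g 0 = utility f p w i := by
    have : Set.projIcc 0 β hβ 0 = z := Subtype.ext (by rw [hproj 0 ⟨le_rfl, hβ⟩, hz])
    simp only [g, r, this, hw]
  rw [hFTC, e1, e2]
  ring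

/-- By budget balance, the utilities add up to the expected value of the allocation, which is the
integral over all thresholds of the probability that the object goes to an agent above it. -/
theorem sum_utility_eq_integral (hf : f.IsRanking fun i => q i) (hb : IsBudgetBalanced p)
    (v : Profile n β) :
    ∑ i, utility f p v i =
      ∫ t in (0 : ℝ)..β, ∑ r ∈ range (countAbove v t), q r := by
  have h1 : ∑ i, utility f p v i = ∑ i, (v i : ℝ) * f v i := by
    simp only [utility, Finset.sum_sub_distrib, hb v, sub_zero]
  have h2 : ∀ i, (v i : ℝ) * f v i =
      ∫ t in (0 : ℝ)..β, (if t < (v i : ℝ) then f v i else 0) := fun i => by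
    rw [integral_ite_lt (h := fun _ => f v i) intervalIntegrable_const (v i).2]
    simp
  rw [h1, Finset.sum_congr rfl fun i _ => h2 i,
    ← intervalIntegral.integral_finsetSum fun i _ =>
      intervalIntegrable_ite_lt (h := fun _ => f v i) intervalIntegrable_const _]
  refine intervalIntegral.integral_congr fun t _ => ?_
  rw [← Finset.sum_filter, countAbove]
  refine sum_prob_upper hf v _ ?_
  simp only [Finset.mem_filter, Finset.mem_univ, true_and]
  exact fun i hi j hij => hi.trans_le hij

end Utility

/-! ### Utilities of agents of valuation zero -/

section BaseWeight

variable {n : ℕ} {β : ℝ} {f : AllocationRule n β} {p : PaymentRule n β} {q : ℕ → ℝ}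

/-- The solution `φ` of `m φ(m - 1) + (n - m) φ(m) = ∑ r < m, q r - m q(m - 1)` for `1 ≤ m < n` with
`φ 0 = 0`. The value at `n`, where the recursion divides by zero, carries no meaning. -/
noncomputable def baseWeight (n : ℕ) (q : ℕ → ℝ) : ℕ → ℝ
  | 0 => 0
  | m + 1 => (∑ r ∈ range (m + 1), q r - (m + 1) * q m - (m + 1) * baseWeight n q m) /
      ((n : ℝ) - (m + 1))

theorem baseWeight_rec {m : ℕ} (hm : m + 1 < n) :
    ((m : ℝ) + 1) * baseWeight n q m + ((n : ℝ) - (m + 1)) * baseWeight n q (m + 1) =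
      ∑ r ∈ range (m + 1), q r - (m + 1) * q m := by
  have h : (n : ℝ) - (m + 1) ≠ 0 := by
    have : ((m + 1 : ℕ) : ℝ) < n := by exact_mod_cast hm
    push_cast at this
    linarith
  rw [baseWeight, mul_div_cancel₀ _ h]
  ring

/-- The utilities that `baseWeight` predicts add up to the right total at every threshold. -/
theorem sum_baseWeight_eq (v : Profile n β) (t : ℝ) (ht : countAbove v t < n) :
    ∑ j, ((if t < (v j : ℝ) then baseWeight n q (countAbove v t - 1)
        else baseWeight n q (countAbove v t)) +
      (if t < (v j : ℝ) then q (countAbove v t - 1) else 0)) =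
      ∑ r ∈ range (countAbove v t), q r := by
  have hnot : ((univ.filter fun j => ¬ t < (v j : ℝ)).card : ℝ) = n - countAbove v t := by
    have := Finset.card_filter_add_card_filter_not (s := (univ : Finset (Fin n)))
      (fun j => t < (v j : ℝ))
    rw [Finset.card_univ, Fintype.card_fin] at this
    rw [eq_sub_iff_add_eq', countAbove]
    exact_mod_cast this
  rw [Finset.sum_add_distrib, Finset.sum_ite, Finset.sum_ite]
  simp only [Finset.sum_const, nsmul_eq_mul, mul_zero, add_zero, hnot]
  rw [← countAbove]
  generalize hm : countAbove v t = m at ht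
  rcases m with _ | m
  · simp [baseWeight]
  · have := baseWeight_rec (q := q) ht
    rw [Nat.add_sub_cancel]
    push_cast
    linarith

/-- The integral over the thresholds of the profile without `i`, in terms of the original profile. -/
theorem integral_comp_countAbove_update_zero (v : Profile n β) (i : Fin n)
    {z : Set.Icc (0 : ℝ) β} (hz : (z : ℝ) = 0) (φ : ℕ → ℝ) :
    ∫ t in (0 : ℝ)..β, φ (countAbove (Function.update v i z) t) =
      ∫ t in (0 : ℝ)..β,
        (if t < (v i : ℝ) then φ (countAbove v t - 1) else φ (countAbove v t)) := by
  refine intervalIntegral.integral_congr fun t ht => ?_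
  rw [Set.uIcc_of_le (z.2.1.trans z.2.2)] at ht
  simp only [countAbove_update_zero v i hz ht.1]
  split_ifs <;> rfl

/-- An agent of valuation zero has the utility `∫ φ (countAbove v t) dt` with `φ = baseWeight`. -/
theorem utility_eq_integral_baseWeight (hf : f.IsRanking fun i => q i) (hfp : IsSatisfactory f p)
    (v : Profile n β) (i : Fin n) (hi : (v i : ℝ) = 0) :
    utility f p v i = ∫ t in (0 : ℝ)..β, baseWeight n q (countAbove v t) := by
  induction hs : (univ.filter fun j => (v j : ℝ) ≠ 0).card using Nat.strong_induction_on
    generalizing v i with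
  | _ s ih =>
  subst hs
  have hβ : (0 : ℝ) ≤ β := (v i).2.1.trans (v i).2.2
  let z : Set.Icc (0 : ℝ) β := v i
  let H : Fin n → ℝ → ℝ := fun j t =>
    if t < (v j : ℝ) then baseWeight n q (countAbove v t - 1) else baseWeight n q (countAbove v t)
  let Q : Fin n → ℝ → ℝ := fun j t => if t < (v j : ℝ) then q (countAbove v t - 1) else 0
  have hHint : ∀ j, IntervalIntegrable (H j) volume 0 β := fun j => by
    have h1 := intervalIntegrable_ite_lt
      (intervalIntegrable_comp_countAbove v (fun m => baseWeight n q (m - 1)) 0 β) (v j)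
    have h2 := intervalIntegrable_ite_lt
      (intervalIntegrable_comp_countAbove v (fun m => baseWeight n q m) 0 β) (v j)
    have h3 := intervalIntegrable_comp_countAbove v (fun m => baseWeight n q m) 0 β
    refine ((h1.add h3).sub h2).congr fun t _ => ?_
    simp only [H]
    split_ifs <;> ring
  have hQint : ∀ j, IntervalIntegrable (Q j) volume 0 β := fun j =>
    intervalIntegrable_ite_lt
      (intervalIntegrable_comp_countAbove v (fun m => q (m - 1)) 0 β) (v j)
  have hQ : ∀ j, utility f p v j = utility f p (Function.update v j z) j +
      ∫ t in (0 : ℝ)..β, Q j t := fun j => by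
    rw [utility_eq_add_integral hf hfp.dsic v j hi, integral_ite_lt
      (intervalIntegrable_comp_countAbove v (fun m => q (m - 1)) 0 β) (v j).2]
    congr 1
    -- the integrands differ at the endpoint `v j` only
    refine intervalIntegral.integral_congr_ae ?_
    filter_upwards [compl_mem_ae_iff.2 (measure_singleton (μ := volume) (v j : ℝ))] with t ht htx
    rw [Set.uIoc_of_le (v j).2.1] at htx
    rw [countAbove_update_zero v j hi htx.1.le, if_pos (lt_of_le_of_ne htx.2 ht)]
  -- agents of positive valuation: induction; agents of valuation zero: symmetry
  have hbase : ∀ j, utility f p (Function.update v j z) j - ∫ t in (0 : ℝ)..β, H j t =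
      if (v j : ℝ) = 0 then
        utility f p v i - ∫ t in (0 : ℝ)..β, baseWeight n q (countAbove v t) else 0 := by
    intro j
    rw [← integral_comp_countAbove_update_zero v j hi (baseWeight n q)]
    split_ifs with hj
    · have hvj : v j = z := Subtype.ext (by rw [hj, hi])
      have hup : Function.update v j z = v := by rw [← hvj, Function.update_eq_self]
      have hsym := hfp.symmetric v j i hvj
      rw [hup]
      simp only [utility, hsym.1, hsym.2, hj, hi]
    · rw [sub_eq_zero]
      refine ih _ (Finset.card_lt_card ?_) (Function.update v j z) j (by simp [z, hi]) rfl
      refine Finset.ssubset_iff_of_subset (fun k hk => ?_) |>.2 ⟨j, by simpa using hj, by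
        simp [z, hi]⟩
      by_cases hkj : k = j
      · subst hkj; simpa using hj
      · simpa [hkj] using hk
  have htotal : ∑ j, (∫ t in (0 : ℝ)..β, H j t) + ∑ j, ∫ t in (0 : ℝ)..β, Q j t =
      ∑ j, utility f p v j := by
    rw [sum_utility_eq_integral hf hfp.budgetBalanced, ← Finset.sum_add_distrib]
    simp only [← intervalIntegral.integral_add (hHint _) (hQint _)]
    rw [← intervalIntegral.integral_finsetSum fun j _ => (hHint j).add (hQint j)]
    refine intervalIntegral.integral_congr fun t ht => ?_
    rw [Set.uIcc_of_le hβ] at ht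
    refine sum_baseWeight_eq v t ?_
    have : (univ.filter fun j => t < (v j : ℝ)) ⊂ univ :=
      Finset.filter_ssubset.2 ⟨i, Finset.mem_univ _, by rw [hi]; exact not_lt.2 ht.1⟩
    simpa [countAbove] using Finset.card_lt_card this
  have hzero : ∑ j, (utility f p (Function.update v j z) j - ∫ t in (0 : ℝ)..β, H j t) = 0 := by
    rw [Finset.sum_congr rfl fun j _ => hQ j, Finset.sum_add_distrib] at htotal
    rw [Finset.sum_sub_distrib]
    linarith
  rw [Finset.sum_congr rfl fun j _ => hbase j, Finset.sum_ite, Finset.sum_const_zero, add_zero,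
    Finset.sum_const, nsmul_eq_mul, mul_eq_zero, sub_eq_zero] at hzero
  refine hzero.resolve_left ?_
  refine Nat.cast_ne_zero.2 ?_
  exact Finset.card_ne_zero_of_mem (a := i) (by simpa using hi)

/-- The equation at `m = n` of the recursion of `baseWeight`, which the existence of payments
imposes: it comes from the profile at which everyone has the valuation `β`. -/
theorem card_mul_baseWeight_pred (hf : f.IsRanking fun i => q i) (hfp : IsSatisfactory f p)
    (hβ : 0 < β) :
    (n : ℝ) * baseWeight n q (n - 1) = ∑ r ∈ range n, q r - n * q (n - 1) := by
  let z : Set.Icc (0 : ℝ) β := ⟨0, le_rfl, hβ.le⟩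
  let v : Profile n β := fun _ => ⟨β, hβ.le, le_rfl⟩
  have hcount : ∀ t, t < β → countAbove v t = n := fun t ht => by simp [countAbove, v, ht]
  have hcount0 : ∀ j t, 0 ≤ t → t < β → countAbove (Function.update v j z) t = n - 1 := by
    intro j t h0 ht
    rw [countAbove_update_zero v j (z := z) rfl h0, if_pos ht, hcount t ht]
  have hconst : ∀ (h : ℝ → ℝ) (c : ℝ), (∀ t, 0 ≤ t → t < β → h t = c) →
      ∫ t in (0 : ℝ)..β, h t = β * c := by
    intro h c hc
    have : ∫ t in (0 : ℝ)..β, h t = ∫ t in (0 : ℝ)..β, c := by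
      refine intervalIntegral.integral_congr_ae ?_
      filter_upwards [compl_mem_ae_iff.2 (measure_singleton (μ := volume) β)] with t ht htx
      rw [Set.uIoc_of_le hβ.le] at htx
      exact hc t htx.1.le (lt_of_le_of_ne htx.2 ht)
    rw [this]
    simp
  have hu : ∀ j, utility f p v j = β * baseWeight n q (n - 1) + β * q (n - 1) := by
    intro j
    rw [utility_eq_add_integral hf hfp.dsic v j (z := z) rfl,
      utility_eq_integral_baseWeight hf hfp (Function.update v j z) j (by simp [z]),
      hconst _ (baseWeight n q (n - 1)) fun t h0 ht => by rw [hcount0 j t h0 ht],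
      hconst _ (q (n - 1)) fun t h0 ht => by rw [hcount0 j t h0 ht]]
  have hsum := sum_utility_eq_integral hf hfp.budgetBalanced v
  rw [hconst _ (∑ r ∈ range n, q r) fun t _ ht => by rw [hcount t ht],
    Finset.sum_congr rfl fun j _ => hu j] at hsum
  simp only [Finset.sum_const, Finset.card_univ, Fintype.card_fin, nsmul_eq_mul] at hsum
  refine mul_left_cancel₀ hβ.ne' ?_
  linarith

/-- Nonnegative weights make the mechanism individually rational. -/
theorem isExPostIR_of_baseWeight_nonneg (hf : f.IsRanking fun i => q i)
    (hfp : IsSatisfactory f p) (hq : ∀ r, 0 ≤ q r) (hφ : ∀ m < n, 0 ≤ baseWeight n q m) :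
    IsExPostIR f p := by
  intro i v
  have hβ : (0 : ℝ) ≤ β := (v i).2.1.trans (v i).2.2
  let z : Set.Icc (0 : ℝ) β := ⟨0, le_rfl, hβ⟩
  have h := utility_eq_add_integral hf hfp.dsic v i (z := z) rfl
  rw [utility_eq_integral_baseWeight hf hfp (Function.update v i z) i (by simp [z])] at h
  change 0 ≤ utility f p v i
  rw [h]
  refine add_nonneg (intervalIntegral.integral_nonneg hβ fun t ht => hφ _ ?_)
    (intervalIntegral.integral_nonneg (v i).2.1 fun t _ => hq _)
  have : (univ.filter fun j => t < (Function.update v i z j : ℝ)) ⊂ univ :=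
    Finset.filter_ssubset.2 ⟨i, Finset.mem_univ _, by simpa [z] using ht.1⟩
  simpa [countAbove] using Finset.card_lt_card this

end BaseWeight

/-! ### Two-step rules -/

section TwoStep

variable {n ℓ : ℕ} {π₁ π₂ : ℝ}

/-- The probabilities of a two-step rule by rank, the rank being an arbitrary natural number. -/
noncomputable def twoStepRank (π₁ π₂ : ℝ) (ℓ : ℕ) (r : ℕ) : ℝ :=
  if r = 0 then π₁ else if r < ℓ then π₂ else 0

theorem sum_twoStepRank {m : ℕ} (hm : m + 1 ≤ ℓ) :
    ∑ r ∈ range (m + 1), twoStepRank π₁ π₂ ℓ r = π₁ + m * π₂ := by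
  induction m with
  | zero => simp [twoStepRank]
  | succ m ih =>
    rw [Finset.sum_range_succ, ih (by omega), twoStepRank, if_neg (by omega), if_pos (by omega)]
    push_cast
    ring

theorem sum_twoStepRank_of_le (hℓ : 1 ≤ ℓ) (hsum : π₁ + ((ℓ : ℝ) - 1) * π₂ = 1) {m : ℕ}
    (hm : ℓ ≤ m) : ∑ r ∈ range m, twoStepRank π₁ π₂ ℓ r = 1 := by
  induction m, hm using Nat.le_induction with
  | base =>
    obtain ⟨k, rfl⟩ := Nat.exists_eq_add_of_le' hℓ
    rw [sum_twoStepRank le_rfl, ← hsum]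
    push_cast
    ring
  | succ m hm ih =>
    rw [Finset.sum_range_succ, ih, twoStepRank, if_neg (by omega), if_neg (by omega), add_zero]

/-- From rank `ℓ` on the equations of `baseWeight`, solved downwards from `m = n`, have the constant
solution `1 / n`. -/
theorem baseWeight_twoStepRank_of_le (hℓ : 1 ≤ ℓ) (hsum : π₁ + ((ℓ : ℝ) - 1) * π₂ = 1)
    (hlast : (n : ℝ) * baseWeight n (twoStepRank π₁ π₂ ℓ) (n - 1) = 1) {m : ℕ} (hm : ℓ ≤ m)
    (hmn : m < n) : (n : ℝ) * baseWeight n (twoStepRank π₁ π₂ ℓ) m = 1 := by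
  have hmn' : m ≤ n - 1 := by omega
  revert hm
  induction hmn' using Nat.decreasingInduction with
  | self => exact fun _ => hlast
  | of_succ m hk ih =>
    intro hm
    have h1 := ih (by omega) (by omega)
    have h2 := baseWeight_rec (n := n) (q := twoStepRank π₁ π₂ ℓ) (m := m) (by omega)
    rw [sum_twoStepRank_of_le hℓ hsum (by omega)] at h2
    have h3 : twoStepRank π₁ π₂ ℓ m = 0 := by
      rw [twoStepRank, if_neg (by omega), if_neg (by omega)]
    rw [h3] at h2
    have hm0 : (m : ℝ) + 1 ≠ 0 := by positivity
    refine mul_left_cancel₀ hm0 ?_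
    linear_combination (n : ℝ) * h2 - ((n : ℝ) - (m + 1)) * h1

/-- Below rank `ℓ` the deviation of `baseWeight` from `(π₁ - π₂) / n` does not grow. -/
theorem abs_baseWeight_twoStepRank_sub_le (hℓ : 2 * ℓ ≤ n + 1) (hπ : π₂ ≤ π₁) {m : ℕ}
    (hm : m < ℓ) :
    |(n : ℝ) * baseWeight n (twoStepRank π₁ π₂ ℓ) m - (π₁ - π₂)| ≤ π₁ - π₂ := by
  have hA : 0 ≤ π₁ - π₂ := sub_nonneg.2 hπ
  induction m with
  | zero => rw [baseWeight, mul_zero, zero_sub, abs_neg, abs_of_nonneg hA]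
  | succ m ih =>
    have hrec := baseWeight_rec (n := n) (q := twoStepRank π₁ π₂ ℓ) (m := m) (by omega)
    rw [sum_twoStepRank (by omega)] at hrec
    have hn : 2 * ((m : ℝ) + 1) ≤ n := by
      have : 2 * (m + 1) ≤ n := by omega
      exact_mod_cast this
    rcases m with _ | m
    · have h1 : baseWeight n (twoStepRank π₁ π₂ ℓ) 1 = 0 := by simp [baseWeight, twoStepRank]
      rw [zero_add, h1, mul_zero, zero_sub, abs_neg, abs_of_nonneg hA]
    · have hq : twoStepRank π₁ π₂ ℓ (m + 1) = π₂ := by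
        rw [twoStepRank, if_neg (by omega), if_pos (by omega)]
      rw [hq] at hrec
      have hih := ih (by omega)
      set a := (n : ℝ) * baseWeight n (twoStepRank π₁ π₂ ℓ) (m + 1) - (π₁ - π₂)
      set b := (n : ℝ) * baseWeight n (twoStepRank π₁ π₂ ℓ) (m + 1 + 1) - (π₁ - π₂)
      have hab : ((n : ℝ) - ((m + 1 : ℕ) + 1)) * b = -(((m + 1 : ℕ) : ℝ) + 1) * a := by
        linear_combination (n : ℝ) * hrec
      have hpos : (0 : ℝ) < ((m + 1 : ℕ) : ℝ) + 1 := by positivity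
      refine le_trans ?_ hih
      refine le_of_mul_le_mul_left ?_ hpos
      calc (((m + 1 : ℕ) : ℝ) + 1) * |b| ≤ ((n : ℝ) - ((m + 1 : ℕ) + 1)) * |b| :=
            mul_le_mul_of_nonneg_right (by linarith) (abs_nonneg _)
        _ = |((n : ℝ) - ((m + 1 : ℕ) + 1)) * b| := by
            rw [abs_mul, abs_of_nonneg (show (0 : ℝ) ≤ n - ((m + 1 : ℕ) + 1) by linarith)]
        _ = (((m + 1 : ℕ) : ℝ) + 1) * |a| := by
            rw [hab, abs_mul, abs_neg, abs_of_pos hpos]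

end TwoStep

end SingleObject

theorem mainTheorem4 (n : ℕ) (hn : 3 ≤ n) (β : ℝ)
    (f : SingleObject.AllocationRule n β) (π₁ : ℝ) (ℓ : ℕ)
    (hf : f.IsTwoStepRanking π₁ ℓ) (hℓ : 2 * ℓ ≤ n + 1)
    (p : SingleObject.PaymentRule n β) (hfp : SingleObject.IsSatisfactory f p) :
    SingleObject.IsExPostIR f p := by
  open SingleObject in
  obtain ⟨hℓ1, -, π₂, hgt, hpos, hsum, hrank⟩ := hf
  have hq : ∀ r, 0 ≤ twoStepRank π₁ π₂ ℓ r := fun r => by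
    unfold twoStepRank
    split_ifs <;> linarith
  have hrank' : f.IsRanking fun i => twoStepRank π₁ π₂ ℓ i := hrank
  rcases le_or_gt β 0 with hβ | hβ
  · -- every valuation is zero, so all agents are tied and pay the same amount, which is zero
    intro i v
    have hv : ∀ j, (v j : ℝ) = 0 := fun j => le_antisymm ((v j).2.2.trans hβ) (v j).2.1
    have hp : ∀ j, p v j = p v i := fun j =>
      (hfp.symmetric v j i (Subtype.ext (by rw [hv, hv]))).2
    have hb := hfp.budgetBalanced v
    rw [Finset.sum_congr rfl fun j _ => hp j, Finset.sum_const, Finset.card_univ,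
      Fintype.card_fin, nsmul_eq_mul, mul_eq_zero] at hb
    have hpi : p v i = 0 := hb.resolve_left (by positivity)
    rw [hv, hpi]
    simp
  have hlast := card_mul_baseWeight_pred hrank' hfp hβ
  have hq0 : twoStepRank π₁ π₂ ℓ (n - 1) = 0 := by
    rw [twoStepRank, if_neg (by omega), if_neg (by omega)]
  rw [sum_twoStepRank_of_le hℓ1 hsum (by omega), hq0, mul_zero, sub_zero] at hlast
  refine isExPostIR_of_baseWeight_nonneg hrank' hfp hq fun m hm => ?_
  have hn0 : (0 : ℝ) < n := by exact_mod_cast (by omega : 0 < n)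
  refine nonneg_of_mul_nonneg_right ?_ hn0
  rcases lt_or_ge m ℓ with h | h
  · have := abs_le.1 (abs_baseWeight_twoStepRank_sub_le (π₂ := π₂) hℓ hgt.le h)
    linarith
  · rw [baseWeight_twoStepRank_of_le hℓ1 hsum hlast h hm]
    exact zero_le_one
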